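/- **Setting.** Let $\|\cdot\|$ be a norm on $\mathbb R^d$ induced by an inner product, let $\mathcal B^*=\{u\in\mathbb R^d: u^Tx\le 1 \text{ whenever } \|x\|\le 1\}$ be the unit ball of the dual norm, and let $\mathcal B_0^*$ be the set of extreme points of $\mathcal B^*$. For a matrix $A\in\mathbb R^{d\times d}$ put $\|A\|=\sup_{u\in\mathcal B^*}\|Au\|$ (the spectral norm when $\|\cdot\|$ is Euclidean). Let $\mathrm{VC}(\mathcal B_0^*)$ be the VC dimension of the family of half-spaces $\{x\in\mathbb R^d:\langle x,v\rangle\ge 0\}$, $v\in\mathcal B_0^*$, where $\langle x,v\rangle=\sum_i x_iv_i$. Let $Y_1,\dots,Y_N$ be i.i.d. random vectors in $\mathbb R^d$ with finite second moments, $\mathbb EY_1=0$ and covariance matrix $\Sigma$, such that $$\sigma^2=\sup_{u\in\mathcal B^*}\mathbb E\left(\left\langle u,(\Sigma-Y_1Y_1^T)u\right\rangle^2\right)<\infty .$$ The observed vectors $X_1,\dots,X_N$ are $\varepsilon$-contaminated: there is a (possibly random) set $\mathcal O\subset\{1,\dots,N\}$ with $|\mathcal O|\le\lfloor\varepsilon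 N\rfloor$ and $X_i=Y_i$ for all $i\notin\mathcal O$; the vectors $X_i$, $i\in\mathcal O$, are arbitrary and may depend on the whole clean sample. For $K\in\{1,\dots,N\}$ let $B_1,\dots,B_K\subset\{1,\dots,N\}$ be pairwise disjoint blocks, fixed independently of the data, each of size $m=\lfloor N/K\rfloor$ (left-over observations are discarded), and let $M_k=\frac1m\sum_{i\in B_k}X_iX_i^T$. With $[z,x]=\operatorname{Tr}(z^Tx)$, put for $r\ge 0$ $$S_u(r)=\left\{A\in\mathbb R^{d\times d}:\ \left|[M_k-A,\,u\otimes u]\right|\le r\ \text{ for more than } K/2 \text{ of the blocks}\right\},\qquad S(r)=\bigcap_{u\in\mathcal B_0^*}S_u(r).$$ **Theorem.** There are universal constants $c,C>0$ such that the following holds for all $d$, $N$ and all norms as above, whenever $\delta\in[e^{-cN},1/2]$, $0\le\varepsilon\le c$ and $\mathrm{VC}(\mathcal B_0^*)\le cN$. There is a number of blocks $K\in\{1,\dots,N\}$, which does not depend on the distribution of $Y_1$, such that for every distribution of $Y_1$, every contamination and every choice of the blocks as above, with $r=4\sigma\sqrt{K/N}$, with probability at least $1-\delta$: the set $S(r)$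 contains a symmetric matrix, and every symmetric $\widehat\Sigma\in S(r)$ satisfies $$\left\|\Sigma-\widehat\Sigma\right\|\le C\,\sigma\left(\sqrt{\frac{\mathrm{VC}(\mathcal B_0^*)}{N}}+\sqrt{\frac{128\log(1/\delta)}{N}}+\sqrt{\varepsilon}\right).$$ No sub-Gaussian or $L_4$–$L_2$ norm-equivalence assumption is made. -/

import Mathlib

open MeasureTheory ProbabilityTheory Matrix

noncomputable section

namespace MOMCov

/-- The norm `‖x‖ = √⟨x, x⟩` on `ℝ^d` induced by the inner product `⟨x, y⟩ = xᵀ G y`, for a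
positive definite matrix `G`. Every norm on `ℝ^d` that comes from an inner product has this form;
`G = 1` is the Euclidean norm. -/
def nrm {d : ℕ} (G : Matrix (Fin d) (Fin d) ℝ) (x : Fin d → ℝ) : ℝ :=
  √(x ⬝ᵥ (G *ᵥ x))

/-- The unit ball `𝓑*` of the dual norm; a vector `u` acts on `x` by `u ⬝ᵥ x = ∑ i, u i * x i`. -/
def dualBall {d : ℕ} (G : Matrix (Fin d) (Fin d) ℝ) : Set (Fin d → ℝ) :=
  {u | ∀ x, nrm G x ≤ 1 → u ⬝ᵥ x ≤ 1}

/-- The set `𝓑₀*` of extreme points of the dual unit ball. -/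
def extremeDual {d : ℕ} (G : Matrix (Fin d) (Fin d) ℝ) : Set (Fin d → ℝ) :=
  (dualBall G).extremePoints ℝ

/-- The operator norm `‖A‖ = sup {‖A u‖ : u ∈ 𝓑*}` of a matrix. The supremum is over a compact
set, so it is finite when `G` is positive definite. For `G = 1` it is the spectral norm. -/
def opNrm {d : ℕ} (G A : Matrix (Fin d) (Fin d) ℝ) : ℝ :=
  sSup ((fun u => nrm G (A *ᵥ u)) '' dualBall G)

/-- The finite set `s` is shattered by the family `𝒞`. -/
def Shattered {α : Type*} (𝒞 : Set (Set α)) (s : Finset α) : Prop :=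
  ∀ t ⊆ s, ∃ C ∈ 𝒞, ∀ x ∈ s, x ∈ C ↔ x ∈ t

/-- The VC dimension of a family of sets: the supremum of the sizes of its shattered finite
sets (possibly `⊤`). -/
def vcDim {α : Type*} (𝒞 : Set (Set α)) : ℕ∞ :=
  ⨆ (s : Finset α) (_ : Shattered 𝒞 s), (s.card : ℕ∞)

/-- `VC(C)` for a set of vectors `C`: the VC dimension of the half-spaces `{x | ⟨x, v⟩ ≥ 0}`,
`v ∈ C`. -/
def vcVec {d : ℕ} (C : Set (Fin d → ℝ)) : ℕ∞ :=
  vcDim ((fun v => {x : Fin d → ℝ | 0 ≤ x ⬝ᵥ v}) '' C)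

/-- The mean vector of a distribution on `ℝ^d`. -/
def mean {d : ℕ} (P : Measure (Fin d → ℝ)) : Fin d → ℝ :=
  fun i => ∫ y, y i ∂P

/-- The covariance matrix `E (Y - μ)(Y - μ)ᵀ` of a distribution on `ℝ^d`. -/
def covMat {d : ℕ} (P : Measure (Fin d → ℝ)) : Matrix (Fin d) (Fin d) ℝ :=
  Matrix.of fun i j => ∫ y, (y i - mean P i) * (y j - mean P j) ∂P

/-- `σ² = sup {E ⟨u, (Σ - Y Yᵀ) u⟩² : u ∈ 𝓑*}`, as an extended nonnegative number. -/
def sigmaSq {d : ℕ} (G : Matrix (Fin d) (Fin d) ℝ) (P : Measure (Fin d → ℝ)) : ENNReal :=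
  ⨆ u ∈ dualBall G,
    ∫⁻ y, ENNReal.ofReal ((u ⬝ᵥ ((covMat P - vecMulVec y y) *ᵥ u)) ^ 2) ∂P

/-- `σ`, meaningful when `sigmaSq G P ≠ ⊤`. -/
def sigma {d : ℕ} (G : Matrix (Fin d) (Fin d) ℝ) (P : Measure (Fin d → ℝ)) : ℝ :=
  √(sigmaSq G P).toReal

/-- `K` pairwise disjoint blocks of `m = ⌊N / K⌋` indices each; left-over data are discarded. -/
def IsBlocking {N K : ℕ} (B : Fin K → Finset (Fin N)) : Prop :=
  (∀ k, (B k).card = N / K) ∧ Pairwise fun k l => Disjoint (B k) (B l)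

/-- The block matrix `(1 / m) ∑ i ∈ b, X_i X_iᵀ`, where `m` is the size of the block `b`. -/
def blockMat {d N : ℕ} (x : Fin N → Fin d → ℝ) (b : Finset (Fin N)) :
    Matrix (Fin d) (Fin d) ℝ :=
  (b.card : ℝ)⁻¹ • ∑ i ∈ b, vecMulVec (x i) (x i)

/-- Trace duality `[z, x] = Tr (zᵀ x)`. -/
def pairing {d : ℕ} (z x : Matrix (Fin d) (Fin d) ℝ) : ℝ := (zᵀ * x).trace

/-- The set `S_u(r)` of matrices `A` with `|[M_k - A, u ⊗ u]| ≤ r` for more than `K / 2` of the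
blocks. -/
def medianSet {d N K : ℕ} (x : Fin N → Fin d → ℝ) (B : Fin K → Finset (Fin N))
    (r : ℝ) (u : Fin d → ℝ) : Set (Matrix (Fin d) (Fin d) ℝ) :=
  {A | (K : ℝ) / 2 <
    ({k : Fin K | |pairing (blockMat x (B k) - A) (vecMulVec u u)| ≤ r}.ncard : ℝ)}

/-- The set `S(r)`, the intersection of the `S_u(r)` over the extreme dual vectors `u`. -/
def momSet {d N K : ℕ} (G : Matrix (Fin d) (Fin d) ℝ) (x : Fin N → Fin d → ℝ)
    (B : Fin K → Finset (Fin N)) (r : ℝ) : Set (Matrix (Fin d) (Fin d) ℝ) :=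
  ⋂ u ∈ extremeDual G, medianSet x B r u

/-- `x` agrees with the clean sample `y` outside a set of at most `⌊ε N⌋` indices. -/
def IsContamination {d N : ℕ} (ε : ℝ) (y x : Fin N → Fin d → ℝ) : Prop :=
  ∃ O : Finset (Fin N), O.card ≤ ⌊ε * N⌋₊ ∧ ∀ i ∉ O, x i = y i

end MOMCov

end

/-!
Let `D` be the dual ball, `S` the covariance matrix, `r = 4 σ √(K / N)`, and call a block bad at `u`
if its clean block matrix `M` satisfies `|⟨u, (M - S) u⟩| > r`. Everything follows from one uniform
statement (`exists_uniform_event`): with high probability fewer than `45 %` of the blocks are bad,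
at all `u ∈ D` simultaneously. Contamination spoils at most `ε N ≤ K / 20` further blocks, so `S`
itself lies in the median set (`mem_momSet_of_exceed_lt`). If `A` lies there too, then at each
extreme `u` the two majorities share a block, which gives `|⟨u, (S - A) u⟩| ≤ 2 r`, and polarization
turns this into a bound of the operator norm (`opNrm_sub_le_of_mem_momSet`).

The uniform statement needs no entropy of a class of quadratic half-spaces. At a fixed `v ∈ D`,
Chebyshev's inequality makes a block exceed the slightly lower level `0.97 r` with probability at
most `0.08` (`measure_quad_block_le`), so by Chernoff's bound at least `15 %` of the blocks do so
with probability at most `exp (-K / 50)` (`measure_card_blocks_le`). To pass from one point to all,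
suppose that `45 %` of the blocks are bad at some `u`. For every `z ∈ D` and every bad block, at
least two of the six points `0.99 u + s z`, `s = ± 10⁻², ± 10⁻⁴, ± 10⁻⁶`, exceed `0.97 r`: the two
signs average out the linear term in `s`, and the quadratic term cannot cancel the value at `u` at
two of the scales. Hence one of the six points sees `15 %` of the blocks above `0.97 r`, and so the
set of such points fills a fraction at least `10^(-6 d) / 6` of the volume of `D`
(`volume_dualBall_le`). By Fubini and Markov (`measure_large_section_le`) this has probability at
most `6 * 10^(6 d) * exp (-K / 50)`.

As `D` is an ellipsoid, its extreme points meet every ray from the origin, so the half-spaces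
shatter a basis and `d` is at most the VC dimension `V` (`dim_le_vcVec`). Hence
`K ≈ 200 log (1 / δ) + 700 V + 20 ε N` blocks suffice.
-/

namespace MOMCov

/-! ### The dual ball as an ellipsoid -/

lemma quad_nonneg {d : ℕ} {G : Matrix (Fin d) (Fin d) ℝ} (hG : G.PosDef) (x : Fin d → ℝ) :
    0 ≤ x ⬝ᵥ (G *ᵥ x) := by
  simpa using hG.posSemidef.dotProduct_mulVec_nonneg x

lemma quad_pos {d : ℕ} {G : Matrix (Fin d) (Fin d) ℝ} (hG : G.PosDef) {x : Fin d → ℝ}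
    (hx : x ≠ 0) : 0 < x ⬝ᵥ (G *ᵥ x) := by
  simpa using hG.dotProduct_mulVec_pos hx

lemma dotProduct_mulVec_symm {d : ℕ} {A : Matrix (Fin d) (Fin d) ℝ} (hA : A.IsSymm)
    (x y : Fin d → ℝ) : x ⬝ᵥ (A *ᵥ y) = y ⬝ᵥ (A *ᵥ x) := by
  rw [dotProduct_mulVec, ← mulVec_transpose, hA.eq, dotProduct_comm]

lemma isSymm_of_posDef {d : ℕ} {G : Matrix (Fin d) (Fin d) ℝ} (hG : G.PosDef) : G.IsSymm := by
  have := hG.isHermitian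
  rwa [IsHermitian, conjTranspose_eq_transpose_of_trivial] at this

lemma mulVec_inv_mulVec {d : ℕ} {G : Matrix (Fin d) (Fin d) ℝ} (hG : G.PosDef)
    (x : Fin d → ℝ) : G *ᵥ (G⁻¹ *ᵥ x) = x := by
  rw [mulVec_mulVec, mul_nonsing_inv _ ((isUnit_iff_isUnit_det _).1 hG.isUnit), one_mulVec]

lemma inv_mulVec_mulVec {d : ℕ} {G : Matrix (Fin d) (Fin d) ℝ} (hG : G.PosDef)
    (x : Fin d → ℝ) : G⁻¹ *ᵥ (G *ᵥ x) = x := by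
  rw [mulVec_mulVec, nonsing_inv_mul _ ((isUnit_iff_isUnit_det _).1 hG.isUnit), one_mulVec]

/-- The inequality `2 ⟨u, x⟩ ≤ ⟨u, G⁻¹ u⟩ + ⟨x, G x⟩`, that is, positivity of `G⁻¹` at
`u - G x`. -/
lemma two_mul_dotProduct_le {d : ℕ} {G : Matrix (Fin d) (Fin d) ℝ} (hG : G.PosDef)
    (u x : Fin d → ℝ) : 2 * (u ⬝ᵥ x) ≤ u ⬝ᵥ (G⁻¹ *ᵥ u) + x ⬝ᵥ (G *ᵥ x) := by
  have h := quad_nonneg hG.inv (u - G *ᵥ x)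
  rw [mulVec_sub, inv_mulVec_mulVec hG, sub_dotProduct, dotProduct_sub, dotProduct_sub,
    dotProduct_comm (G *ᵥ x) (G⁻¹ *ᵥ u), dotProduct_comm (G *ᵥ x) x,
    dotProduct_mulVec_symm (isSymm_of_posDef hG), mulVec_inv_mulVec hG,
    dotProduct_comm x u] at h
  linarith

lemma mem_dualBall_iff {d : ℕ} {G : Matrix (Fin d) (Fin d) ℝ} (hG : G.PosDef)
    (u : Fin d → ℝ) : u ∈ dualBall G ↔ u ⬝ᵥ (G⁻¹ *ᵥ u) ≤ 1 := by
  constructor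
  · intro h
    by_contra! hq
    set q := u ⬝ᵥ (G⁻¹ *ᵥ u) with hqd
    have h0 : 0 < √q := Real.sqrt_pos.2 (by linarith)
    have hs : √q * √q = q := Real.mul_self_sqrt (by linarith)
    have h1 := h ((√q)⁻¹ • (G⁻¹ *ᵥ u)) (by
      rw [nrm, mulVec_smul, mulVec_inv_mulVec hG, smul_dotProduct, dotProduct_smul,
        dotProduct_comm, ← hqd, smul_eq_mul, smul_eq_mul, Real.sqrt_le_one]
      rw [← mul_assoc, ← mul_inv, hs, inv_mul_cancel₀ (by linarith)])
    rw [dotProduct_smul, ← hqd, smul_eq_mul] at h1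
    have h2 : (√q)⁻¹ * q = √q := by
      nth_rw 2 [← hs]
      field_simp
    rw [h2, Real.sqrt_le_one] at h1
    linarith
  · intro h x hx
    have h1 : x ⬝ᵥ (G *ᵥ x) ≤ 1 := by rwa [nrm, Real.sqrt_le_one] at hx
    have := two_mul_dotProduct_le hG u x
    linarith

lemma zero_mem_dualBall {d : ℕ} (G : Matrix (Fin d) (Fin d) ℝ) :
    (0 : Fin d → ℝ) ∈ dualBall G := fun x _ => by simp

lemma neg_mem_dualBall {d : ℕ} {G : Matrix (Fin d) (Fin d) ℝ} {u : Fin d → ℝ}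
    (hu : u ∈ dualBall G) : -u ∈ dualBall G := fun x hx => by
  have := hu (-x) (by simpa [nrm, mulVec_neg] using hx)
  simpa using this

lemma volume_dualBall_pos {d : ℕ} {G : Matrix (Fin d) (Fin d) ℝ} (hG : G.PosDef) :
    0 < volume (dualBall G) := by
  have ho : IsOpen {u : Fin d → ℝ | u ⬝ᵥ (G⁻¹ *ᵥ u) < 1} :=
    isOpen_lt (by fun_prop) continuous_const
  refine (ho.measure_pos volume ⟨0, by simp⟩).trans_le (measure_mono fun u hu => ?_)
  exact (mem_dualBall_iff hG u).2 (le_of_lt hu)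

lemma volume_dualBall_ne_top {d : ℕ} {G : Matrix (Fin d) (Fin d) ℝ} (hG : G.PosDef) :
    volume (dualBall G) ≠ ⊤ := by
  have hup : ∀ u ∈ dualBall G, ∀ i, u i ≤ (1 + G i i) / 2 := by
    intro u hu i
    have h := two_mul_dotProduct_le hG u (Pi.single i 1)
    have h1 := (mem_dualBall_iff hG u).1 hu
    simp at h
    linarith
  have hsub : dualBall G ⊆ Set.Icc (fun i => -((1 + G i i) / 2)) (fun i => (1 + G i i) / 2) := by
    intro u hu
    refine ⟨fun i => ?_, fun i => hup u hu i⟩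
    have := hup _ (neg_mem_dualBall hu) i
    rw [Pi.neg_apply] at this
    linarith
  exact ((measure_mono hsub).trans_lt isCompact_Icc.measure_lt_top).ne

/-- Extreme points of the dual ball: the ellipsoid `⟨u, G⁻¹ u⟩ ≤ 1` is strictly convex, so every
point of its boundary is extreme. -/
lemma mem_extremeDual_of_quad_eq_one {d : ℕ} {G : Matrix (Fin d) (Fin d) ℝ} (hG : G.PosDef)
    {u : Fin d → ℝ} (hu : u ⬝ᵥ (G⁻¹ *ᵥ u) = 1) : u ∈ extremeDual G := by
  refine ⟨(mem_dualBall_iff hG u).2 hu.le, ?_⟩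
  rintro x hx y hy ⟨a, b, ha, hb, hab, rfl⟩
  rw [mem_dualBall_iff hG] at hx hy
  have hxy := dotProduct_mulVec_symm (isSymm_of_posDef hG.inv) x y
  have hz : x = y := by
    by_contra hne
    have h := quad_pos hG.inv (sub_ne_zero.2 hne)
    simp only [mulVec_sub, mulVec_add, mulVec_smul, sub_dotProduct, dotProduct_sub,
      add_dotProduct, dotProduct_add, smul_dotProduct, dotProduct_smul, smul_eq_mul] at h hu
    rw [hxy] at h hu
    obtain rfl : b = 1 - a := by linarith
    nlinarith [mul_pos (mul_pos ha hb) h, mul_le_mul_of_nonneg_left hx ha.le,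
      mul_le_mul_of_nonneg_left hy hb.le]
  subst hz
  rw [← add_smul, hab, one_smul]

lemma exists_smul_mem_extremeDual {d : ℕ} {G : Matrix (Fin d) (Fin d) ℝ} (hG : G.PosDef)
    {v : Fin d → ℝ} (hv : v ≠ 0) : ∃ a : ℝ, 0 < a ∧ a ^ 2 * (v ⬝ᵥ (G⁻¹ *ᵥ v)) = 1 ∧
      a • v ∈ extremeDual G := by
  have hq := quad_pos hG.inv hv
  have hs : √(v ⬝ᵥ (G⁻¹ *ᵥ v)) ^ 2 = v ⬝ᵥ (G⁻¹ *ᵥ v) := Real.sq_sqrt hq.le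
  have h1 : (√(v ⬝ᵥ (G⁻¹ *ᵥ v)))⁻¹ ^ 2 * (v ⬝ᵥ (G⁻¹ *ᵥ v)) = 1 := by
    rw [inv_pow, hs, inv_mul_cancel₀ hq.ne']
  refine ⟨_, inv_pos.2 (Real.sqrt_pos.2 hq), h1, mem_extremeDual_of_quad_eq_one hG ?_⟩
  rw [mulVec_smul, smul_dotProduct, dotProduct_smul, smul_eq_mul, smul_eq_mul, ← mul_assoc,
    ← sq, h1]

/-- The half-spaces `{x | 0 ≤ ⟨x, v⟩}`, `v ∈ 𝓑₀*`, shatter the standard basis, because `𝓑₀*`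
meets every open ray from the origin. -/
lemma dim_le_vcVec {d : ℕ} {G : Matrix (Fin d) (Fin d) ℝ} (hG : G.PosDef) :
    (d : ℕ∞) ≤ vcVec (extremeDual G) := by
  classical
  rcases Nat.eq_zero_or_pos d with rfl | hd
  · simp
  let e : Fin d → Fin d → ℝ := fun i => Pi.single i 1
  have he : Function.Injective e := fun i j h => by
    by_contra hij
    have := congrFun h i
    simp [e, hij] at this
  have hsh : Shattered ((fun v => {x : Fin d → ℝ | 0 ≤ x ⬝ᵥ v}) '' extremeDual G)
      (Finset.univ.image e) := by
    intro t _
    let v : Fin d → ℝ := fun i => if e i ∈ t then 1 else -1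
    have hv : v ≠ 0 := fun h => by
      have := congrFun h ⟨0, hd⟩
      simp only [v, Pi.zero_apply] at this
      split_ifs at this <;> norm_num at this
    obtain ⟨a, ha, -, hmem⟩ := exists_smul_mem_extremeDual hG hv
    refine ⟨_, ⟨_, hmem, rfl⟩, fun x hx => ?_⟩
    obtain ⟨i, -, rfl⟩ := Finset.mem_image.1 hx
    simp only [Set.mem_ofPred_eq, dotProduct_smul, smul_eq_mul, e, single_dotProduct, one_mul]
    rw [mul_nonneg_iff_of_pos_left ha]
    by_cases h : e i ∈ t
    · simp only [v, h, if_true]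
      norm_num
      exact h
    · simp only [v, h, if_false]
      norm_num
      exact h
  have hc : (Finset.univ.image e).card = d := by
    rw [Finset.card_image_of_injective _ he, Finset.card_univ, Fintype.card_fin]
  calc (d : ℕ∞) = ((Finset.univ.image e).card : ℕ∞) := by rw [hc]
    _ ≤ _ := le_iSup₂ (f := fun (s : Finset (Fin d → ℝ))
      (_ : Shattered ((fun v => {x : Fin d → ℝ | 0 ≤ x ⬝ᵥ v}) '' extremeDual G) s) =>
        (s.card : ℕ∞)) _ hsh

/-! ### Quadratic forms and the operator norm -/

lemma pairing_vecMulVec {d : ℕ} (A : Matrix (Fin d) (Fin d) ℝ) (u : Fin d → ℝ) :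
    pairing A (vecMulVec u u) = u ⬝ᵥ (A *ᵥ u) := by
  rw [pairing, mul_vecMulVec, trace_vecMulVec, mulVec_transpose,
    ← dotProduct_mulVec]

/-- For a symmetric matrix, the quadratic form on `𝓑₀*` controls the operator norm:
homogeneity extends the bound to all vectors, polarization to the bilinear form. -/
lemma opNrm_le_of_quad_le {d : ℕ} {G A : Matrix (Fin d) (Fin d) ℝ} (hG : G.PosDef)
    (hA : A.IsSymm) {R : ℝ} (hR : 0 ≤ R)
    (h : ∀ u ∈ extremeDual G, |u ⬝ᵥ (A *ᵥ u)| ≤ R) : opNrm G A ≤ R := by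
  have hq : ∀ v : Fin d → ℝ, |v ⬝ᵥ (A *ᵥ v)| ≤ R * (v ⬝ᵥ (G⁻¹ *ᵥ v)) := by
    intro v
    rcases eq_or_ne v 0 with rfl | hv
    · simp
    obtain ⟨a, ha, haq, hmem⟩ := exists_smul_mem_extremeDual hG hv
    have h1 := h _ hmem
    rw [mulVec_smul, smul_dotProduct, dotProduct_smul, smul_eq_mul, smul_eq_mul, ← mul_assoc,
      ← sq, abs_mul, abs_of_nonneg (sq_nonneg a)] at h1
    refine le_of_mul_le_mul_left ?_ (pow_pos ha 2)
    calc a ^ 2 * |v ⬝ᵥ (A *ᵥ v)| ≤ R := h1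
      _ = a ^ 2 * (R * (v ⬝ᵥ (G⁻¹ *ᵥ v))) := by rw [mul_left_comm, haq, mul_one]
  have hpol : ∀ u ∈ dualBall G, ∀ z ∈ dualBall G, z ⬝ᵥ (A *ᵥ u) ≤ R := by
    intro u hu z hz
    rw [mem_dualBall_iff hG] at hu hz
    have h1 := (abs_le.1 (hq (z + u))).2
    have h2 := (abs_le.1 (hq (z - u))).1
    have h3 := dotProduct_mulVec_symm hA z u
    simp only [mulVec_sub, mulVec_add, sub_dotProduct, dotProduct_sub, add_dotProduct,
      dotProduct_add] at h1 h2
    nlinarith [mul_le_mul_of_nonneg_left hu hR, mul_le_mul_of_nonneg_left hz hR]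
  refine csSup_le ⟨_, 0, zero_mem_dualBall G, rfl⟩ ?_
  rintro _ ⟨u, hu, rfl⟩
  -- `nrm G w` is attained at the dual vector `G w / nrm G w`.
  change nrm G (A *ᵥ u) ≤ R
  set w := A *ᵥ u with hw
  rcases eq_or_ne w 0 with h0 | h0
  · simpa [nrm, h0] using hR
  have hn := quad_pos hG h0
  have hs : √(w ⬝ᵥ (G *ᵥ w)) * √(w ⬝ᵥ (G *ᵥ w)) = w ⬝ᵥ (G *ᵥ w) := Real.mul_self_sqrt hn.le
  have hp : 0 < √(w ⬝ᵥ (G *ᵥ w)) := Real.sqrt_pos.2 hn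
  have h1 := hpol u hu ((√(w ⬝ᵥ (G *ᵥ w)))⁻¹ • (G *ᵥ w)) (by
    rw [mem_dualBall_iff hG, mulVec_smul, inv_mulVec_mulVec hG, smul_dotProduct, dotProduct_smul,
      dotProduct_comm (G *ᵥ w) w, smul_eq_mul, smul_eq_mul, ← mul_assoc, ← mul_inv, hs,
      inv_mul_cancel₀ hn.ne'])
  rw [← hw, smul_dotProduct, dotProduct_comm (G *ᵥ w), smul_eq_mul] at h1
  have h2 : (√(w ⬝ᵥ (G *ᵥ w)))⁻¹ * (w ⬝ᵥ (G *ᵥ w)) = √(w ⬝ᵥ (G *ᵥ w)) := by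
    nth_rw 2 [← hs]
    rw [inv_mul_cancel_left₀ hp.ne']
  rw [h2] at h1
  exact h1

/-! ### Smoothing a quadratic form over the dual ball -/

/-- The indices `k` whose quadratic form exceeds `ρ` in absolute value at `v`. -/
noncomputable def exceed {d K : ℕ} (A : Fin K → Matrix (Fin d) (Fin d) ℝ) (ρ : ℝ) (v : Fin d → ℝ) :
    Finset (Fin K) :=
  open Classical in Finset.univ.filter fun k => ρ < |v ⬝ᵥ (A k *ᵥ v)|

lemma quad_add_smul {d : ℕ} (A : Matrix (Fin d) (Fin d) ℝ) (u z : Fin d → ℝ) (a b : ℝ) :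
    (a • u + b • z) ⬝ᵥ (A *ᵥ (a • u + b • z)) =
      a ^ 2 * (u ⬝ᵥ (A *ᵥ u)) + a * b * (u ⬝ᵥ (A *ᵥ z) + z ⬝ᵥ (A *ᵥ u))
        + b ^ 2 * (z ⬝ᵥ (A *ᵥ z)) := by
  simp only [mulVec_add, mulVec_smul, add_dotProduct, dotProduct_add, smul_dotProduct,
    dotProduct_smul, smul_eq_mul]
  ring

/-- A quadratic form that exceeds `r` at `u` almost exceeds `r` at one of the two points
`0.99 u ± b z`, except for at most one of two very different scales `b`: the mean over the two
signs removes the linear term in `b`, and the term `b² ⟨z, A z⟩` cannot cancel the value at `u` at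
both scales. -/
lemma exceed_of_two_scales {d : ℕ} {A : Matrix (Fin d) (Fin d) ℝ} {r b b' : ℝ} (hr : 0 ≤ r)
    (hb : 0 < b') (hbb : 100 * b' ≤ b) {u z : Fin d → ℝ} (hu : r < |u ⬝ᵥ (A *ᵥ u)|) :
    (∃ s ∈ ({b, -b} : Finset ℝ), 0.97 * r <
      |((0.99 : ℝ) • u + s • z) ⬝ᵥ (A *ᵥ ((0.99 : ℝ) • u + s • z))|) ∨
    (∃ s ∈ ({b', -b'} : Finset ℝ), 0.97 * r <
      |((0.99 : ℝ) • u + s • z) ⬝ᵥ (A *ᵥ ((0.99 : ℝ) • u + s • z))|) := by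
  by_contra! hc
  obtain ⟨h1, h2⟩ := hc
  have e1 := h1 b (by simp)
  have e2 := h1 (-b) (by simp)
  have e3 := h2 b' (by simp)
  have e4 := h2 (-b') (by simp)
  rw [quad_add_smul, abs_le] at e1 e2 e3 e4
  set q := u ⬝ᵥ (A *ᵥ u)
  set c := z ⬝ᵥ (A *ᵥ z)
  have f1 : |0.99 ^ 2 * q + b ^ 2 * c| ≤ 0.97 * r := abs_le.2 ⟨by linarith, by linarith⟩
  have f2 : |0.99 ^ 2 * q + b' ^ 2 * c| ≤ 0.97 * r := abs_le.2 ⟨by linarith, by linarith⟩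
  clear e1 e2 e3 e4 h1 h2
  rw [abs_le] at f1 f2
  -- Eliminate `c` with the weight `t = (b' / b)²`, which is at most `10⁻⁴`.
  have hbp : 0 < b := by linarith
  obtain ⟨t, ht0, ht, hbt⟩ : ∃ t : ℝ, 0 ≤ t ∧ t ≤ 1 / 10000 ∧ b' ^ 2 = t * b ^ 2 := by
    refine ⟨(b' / b) ^ 2, by positivity, ?_, by field_simp⟩
    have : b' / b ≤ 1 / 100 := by rw [div_le_iff₀ hbp]; linarith
    calc (b' / b) ^ 2 ≤ (1 / 100) ^ 2 := by gcongr
      _ = _ := by norm_num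
  rw [hbt] at f2
  have g1 : 0.99 ^ 2 * q * (1 - t) ≤ 0.97 * r * (1 + t) := by
    nlinarith [mul_le_mul_of_nonneg_left f1.1 ht0]
  have g2 : -(0.97 * r * (1 + t)) ≤ 0.99 ^ 2 * q * (1 - t) := by
    nlinarith [mul_le_mul_of_nonneg_left f1.2 ht0]
  have g3 : 0.97 * r * (1 + t) ≤ 0.99 ^ 2 * r * (1 - t) := by nlinarith
  rcases abs_cases q with ⟨h, -⟩ | ⟨h, -⟩
  · rw [h] at hu
    nlinarith
  · rw [h] at hu
    nlinarith

/-- The six radii `± 10⁻²`, `± 10⁻⁴`, `± 10⁻⁶` of the smoothing argument. -/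
noncomputable def radii : Finset ℝ := {1/100, -(1/100), 1/10000, -(1/10000), 1/1000000, -(1/1000000)}

lemma card_radii : radii.card = 6 := by
  rw [radii]
  norm_num [Finset.card_insert_of_notMem]

/-- By `exceed_of_two_scales` at most one of the three scales fails, and each of the others
contributes a radius. -/
lemma two_le_card_radii {d : ℕ} {A : Matrix (Fin d) (Fin d) ℝ} {r : ℝ} (hr : 0 ≤ r)
    {u : Fin d → ℝ} (z : Fin d → ℝ) (hu : r < |u ⬝ᵥ (A *ᵥ u)|) :
    2 ≤ (open Classical in radii.filter fun s => 0.97 * r <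
      |((0.99 : ℝ) • u + s • z) ⬝ᵥ (A *ᵥ ((0.99 : ℝ) • u + s • z))|).card := by
  classical
  have key : ∀ b b' : ℝ, 0 < b' → 100 * b' ≤ b → _ := fun b b' h h' =>
    exceed_of_two_scales (z := z) hr h h' hu
  have h12 := key (1/100) (1/10000) (by norm_num) (by norm_num)
  have h13 := key (1/100) (1/1000000) (by norm_num) (by norm_num)
  have h23 := key (1/10000) (1/1000000) (by norm_num) (by norm_num)
  have hone : ∀ s ∈ radii, ∀ t ∈ radii, s ≠ t →
      0.97 * r < |((0.99 : ℝ) • u + s • z) ⬝ᵥ (A *ᵥ ((0.99 : ℝ) • u + s • z))| →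
      0.97 * r < |((0.99 : ℝ) • u + t • z) ⬝ᵥ (A *ᵥ ((0.99 : ℝ) • u + t • z))| →
      2 ≤ (radii.filter fun s => 0.97 * r <
      |((0.99 : ℝ) • u + s • z) ⬝ᵥ (A *ᵥ ((0.99 : ℝ) • u + s • z))|).card := by
    intro s hs t ht hst h1 h2
    refine Finset.one_lt_card.2 ⟨s, ?_, t, ?_, hst⟩ <;> simp_all
  have hdis : ∀ b b' : ℝ, 0 < b' → 100 * b' ≤ b → ∀ s ∈ ({b, -b} : Finset ℝ),
      ∀ t ∈ ({b', -b'} : Finset ℝ), s ≠ t := by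
    intro b b' h h' s hs t ht
    simp only [Finset.mem_insert, Finset.mem_singleton] at hs ht
    rcases hs with rfl | rfl <;> rcases ht with rfl | rfl <;> intro h0 <;> linarith
  have s1 : ({1/100, -(1/100)} : Finset ℝ) ⊆ radii := by intro s; simp [radii]; tauto
  have s2 : ({1/10000, -(1/10000)} : Finset ℝ) ⊆ radii := by intro s; simp [radii]; tauto
  have s3 : ({1/1000000, -(1/1000000)} : Finset ℝ) ⊆ radii := by intro s; simp [radii]; tauto
  rcases h12 with ⟨s, hs, h⟩ | ⟨s, hs, h⟩
  · rcases h23 with ⟨t, ht, h'⟩ | ⟨t, ht, h'⟩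
    · exact hone s (s1 hs) t (s2 ht)
        (hdis _ _ (by norm_num) (by norm_num) s hs t ht) h h'
    · exact hone s (s1 hs) t (s3 ht)
        (hdis _ _ (by norm_num) (by norm_num) s hs t ht) h h'
  · rcases h13 with ⟨t, ht, h'⟩ | ⟨t, ht, h'⟩
    · exact hone t (s1 ht) s (s2 hs)
        (hdis _ _ (by norm_num) (by norm_num) t ht s hs) h' h
    · exact hone s (s2 hs) t (s3 ht)
        (hdis _ _ (by norm_num) (by norm_num) s hs t ht) h h'

/-- Double counting over the six radii: some point `0.99 u + s z` sees at least a third of the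
indices that exceed `r` at `u`. -/
lemma exists_radius_card_exceed {d K : ℕ} (A : Fin K → Matrix (Fin d) (Fin d) ℝ) {r : ℝ}
    (hr : 0 ≤ r) (u z : Fin d → ℝ) :
    ∃ s ∈ radii, (exceed A r u).card ≤
      3 * (exceed A (0.97 * r) ((0.99 : ℝ) • u + s • z)).card := by
  classical
  have h := Finset.sum_le_sum fun k (hk : k ∈ exceed A r u) =>
    two_le_card_radii hr z (by simpa [exceed] using hk)
  by_contra! hc
  have h2 : ∑ s ∈ radii, 3 * (exceed A (0.97 * r) ((0.99 : ℝ) • u + s • z)).card <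
      ∑ _s ∈ radii, (exceed A r u).card :=
    Finset.sum_lt_sum_of_nonempty (Finset.card_pos.1 (by rw [card_radii]; norm_num)) hc
  rw [Finset.sum_const, card_radii, ← Finset.mul_sum] at h2
  rw [Finset.sum_const] at h
  have h3 : ∑ k ∈ exceed A r u, (radii.filter fun s => 0.97 * r <
      |((0.99 : ℝ) • u + s • z) ⬝ᵥ (A k *ᵥ ((0.99 : ℝ) • u + s • z))|).card ≤
      ∑ s ∈ radii, (exceed A (0.97 * r) ((0.99 : ℝ) • u + s • z)).card := by
    simp only [Finset.card_filter, exceed]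
    rw [Finset.sum_comm]
    exact Finset.sum_le_sum fun s _ =>
      Finset.sum_le_sum_of_subset (Finset.subset_univ _)
  simp only [smul_eq_mul] at h h2
  omega

lemma radii_abs {s : ℝ} (hs : s ∈ radii) : 1 / 1000000 ≤ |s| ∧ |s| ≤ 1 / 100 := by
  simp only [radii, Finset.mem_insert, Finset.mem_singleton] at hs
  rcases hs with rfl | rfl | rfl | rfl | rfl | rfl <;> norm_num [abs_of_pos, abs_neg]

lemma smooth_mem_dualBall {d : ℕ} {G : Matrix (Fin d) (Fin d) ℝ} {u z : Fin d → ℝ}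
    (hu : u ∈ dualBall G) (hz : z ∈ dualBall G) {s : ℝ} (hs : s ∈ radii) :
    (0.99 : ℝ) • u + s • z ∈ dualBall G := by
  intro x hx
  have h1 := hu x hx
  have h2 := abs_le.2 ⟨by simpa using neg_le_neg (neg_mem_dualBall hz x hx), hz x hx⟩
  have h3 : s * (z ⬝ᵥ x) ≤ 1 / 100 := by
    calc s * (z ⬝ᵥ x) ≤ |s * (z ⬝ᵥ x)| := le_abs_self _
      _ = |s| * |z ⬝ᵥ x| := abs_mul _ _
      _ ≤ 1 / 100 * 1 := by gcongr; exact (radii_abs hs).2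
      _ = _ := by norm_num
  rw [add_dotProduct, smul_dotProduct, smul_dotProduct, smul_eq_mul, smul_eq_mul]
  linarith

/-- If at least `3 n` forms exceed `r` at one point `u` of the dual ball, then at least `n` of them
exceed `0.97 r` on a part of the ball of relative volume at least `10^(-6 d) / 6`. -/
lemma volume_dualBall_le {d K : ℕ} {G : Matrix (Fin d) (Fin d) ℝ}
    (A : Fin K → Matrix (Fin d) (Fin d) ℝ) {r : ℝ} (hr : 0 ≤ r) {n : ℝ} {u : Fin d → ℝ}
    (hu : u ∈ dualBall G) (hn : 3 * n ≤ (exceed A r u).card) :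
    volume (dualBall G) ≤ ENNReal.ofReal (6 * 1000000 ^ d) *
      volume {v ∈ dualBall G | n ≤ (exceed A (0.97 * r) v).card} := by
  set W := {v ∈ dualBall G | n ≤ (exceed A (0.97 * r) v).card}
  have hsub : dualBall G ⊆ ⋃ s ∈ radii, (fun z => (0.99 : ℝ) • u + s • z) ⁻¹' W := by
    intro z hz
    obtain ⟨s, hs, h⟩ := exists_radius_card_exceed A hr u z
    refine Set.mem_iUnion₂.2 ⟨s, hs, smooth_mem_dualBall hu hz hs, ?_⟩
    have : ((exceed A r u).card : ℝ) ≤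
      3 * (exceed A (0.97 * r) ((0.99 : ℝ) • u + s • z)).card := by exact_mod_cast h
    linarith
  have hs : ∀ s ∈ radii, volume ((fun z => (0.99 : ℝ) • u + s • z) ⁻¹' W) ≤
      ENNReal.ofReal (1000000 ^ d) * volume W := by
    intro s hs
    have h0 : 0 < |s| := lt_of_lt_of_le (by norm_num) (radii_abs hs).1
    have he : (fun z : Fin d → ℝ => (0.99 : ℝ) • u + s • z) ⁻¹' W =
      (fun z => s • z) ⁻¹' ((fun z => (0.99 : ℝ) • u + z) ⁻¹' W) := rfl
    rw [he, Measure.addHaar_preimage_smul _ (abs_pos.1 h0), measure_preimage_add]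
    gcongr
    rw [Module.finrank_fin_fun, abs_inv, abs_pow, ← inv_pow]
    gcongr
    rw [inv_le_comm₀ h0 (by norm_num)]
    simpa using (radii_abs hs).1
  calc volume (dualBall G) ≤ _ := measure_mono hsub
    _ ≤ ∑ s ∈ radii, volume ((fun z => (0.99 : ℝ) • u + s • z) ⁻¹' W) :=
      measure_biUnion_finset_le _ _
    _ ≤ ∑ _s ∈ radii, ENNReal.ofReal (1000000 ^ d) * volume W := Finset.sum_le_sum hs
    _ = _ := by
      rw [Finset.sum_const, card_radii, ENNReal.ofReal_mul (by norm_num), nsmul_eq_mul, mul_assoc]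
      norm_num

/-! ### Independence across disjoint blocks -/

/-- For independent variables, the integral of a product of functions of disjoint blocks is the
product of the integrals. Dependence on a block only is expressed by `hdep`. -/
lemma lintegral_prod_blocks {Ω ι κ E : Type*} [MeasurableSpace Ω] [MeasurableSpace E]
    [Inhabited E] {μ : Measure Ω} [IsProbabilityMeasure μ] {Y : ι → Ω → E}
    (hY : ∀ i, Measurable (Y i)) (hind : iIndepFun Y μ) {B : κ → Finset ι}
    (hB : Pairwise fun k l => Disjoint (B k) (B l)) {g : κ → (ι → E) → ENNReal}
    (hg : ∀ k, Measurable (g k))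
    (hdep : ∀ k y y', (∀ i ∈ B k, y i = y' i) → g k y = g k y') (s : Finset κ) :
    ∫⁻ ω, ∏ k ∈ s, g k (fun i => Y i ω) ∂μ = ∏ k ∈ s, ∫⁻ ω, g k (fun i => Y i ω) ∂μ := by
  classical
  have hYm : Measurable fun ω i => Y i ω := measurable_pi_lambda _ hY
  induction s using Finset.induction_on with
  | empty => simp
  | insert k s hk ih =>
    simp_rw [Finset.prod_insert hk]
    rw [← ih]
    let ext : (S : Finset ι) → (S → E) → ι → E :=
      fun S z i => if h : i ∈ S then z ⟨i, h⟩ else default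
    have hext : ∀ S, Measurable (ext S) := fun S => measurable_pi_lambda _ fun i => by
      by_cases h : i ∈ S
      · simpa [ext, h] using measurable_pi_apply _
      · simp [ext, h]
    have hdis : Disjoint (B k) (s.biUnion B) :=
      (Finset.disjoint_biUnion_right _ _ _).2 fun l hl =>
        hB fun h => hk (h ▸ hl)
    have hi := (hind.indepFun_finset (B k) (s.biUnion B) hdis hY).comp
      ((hg k).comp (hext _))
      ((Finset.measurable_fun_prod s fun l _ => hg l).comp (hext _))
    have e1 : (g k ∘ ext (B k)) ∘ (fun ω (i : B k) => Y i ω) =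
        fun ω => g k (fun i => Y i ω) := by
      funext ω
      exact hdep k _ _ fun i hi => by simp [ext, hi]
    have e2 : ((fun y => ∏ l ∈ s, g l y) ∘ ext (s.biUnion B)) ∘
        (fun ω (i : s.biUnion B) => Y i ω) = fun ω => ∏ l ∈ s, g l (fun i => Y i ω) := by
      funext ω
      refine Finset.prod_congr rfl fun l hl => hdep l _ _ fun i hi => ?_
      have : i ∈ s.biUnion B := Finset.mem_biUnion.2 ⟨l, hl, hi⟩
      simp only [ext, this, dif_pos]
    rw [e1, e2] at hi
    exact lintegral_mul_eq_lintegral_mul_lintegral_of_indepFun ((hg k).comp hYm)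
      (Finset.measurable_fun_prod s fun l _ => (hg l).comp hYm) hi

/-- Chernoff's bound, from the moment `E 2^#`, for the number of blocks at which an event of
probability at most `0.08` occurs. -/
lemma measure_card_blocks_le {Ω ι E : Type*} {K : ℕ} [MeasurableSpace Ω] [MeasurableSpace E]
    [Inhabited E] {μ : Measure Ω} [IsProbabilityMeasure μ] {Y : ι → Ω → E}
    (hY : ∀ i, Measurable (Y i)) (hind : iIndepFun Y μ) {B : Fin K → Finset ι}
    (hB : Pairwise fun k l => Disjoint (B k) (B l)) {s : Fin K → Set (ι → E)}
    (hs : ∀ k, MeasurableSet (s k))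
    (hdep : ∀ k y y', (∀ i ∈ B k, y i = y' i) → (y ∈ s k ↔ y' ∈ s k))
    (hp : ∀ k, μ {ω | (fun i => Y i ω) ∈ s k} ≤ ENNReal.ofReal 0.08) :
    μ {ω | 0.15 * (K : ℝ) ≤
      ((open Classical in Finset.univ.filter fun k => (fun i => Y i ω) ∈ s k).card : ℝ)} ≤
      ENNReal.ofReal (Real.exp (-(K / 50))) := by
  classical
  have hYm : Measurable fun ω i => Y i ω := measurable_pi_lambda _ hY
  let g : Fin K → (ι → E) → ENNReal := fun k y => if y ∈ s k then 2 else 1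
  have hg : ∀ k, Measurable (g k) := fun k =>
    Measurable.ite (hs k) measurable_const measurable_const
  have hprod := lintegral_prod_blocks hY hind hB hg
    (fun k y y' h => by simp only [g, hdep k y y' h]) Finset.univ
  have hle : ∀ k, ∫⁻ ω, g k (fun i => Y i ω) ∂μ ≤ ENNReal.ofReal 1.08 := by
    intro k
    have hm : MeasurableSet {ω | (fun i => Y i ω) ∈ s k} := hYm (hs k)
    calc ∫⁻ ω, g k (fun i => Y i ω) ∂μ
        = ∫⁻ ω, (1 + Set.indicator {ω | (fun i => Y i ω) ∈ s k} 1 ω) ∂μ := by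
          refine lintegral_congr fun ω => ?_
          by_cases h : (fun i => Y i ω) ∈ s k
          · simp [g, h, one_add_one_eq_two]
          · simp [g, h]
      _ = 1 + μ {ω | (fun i => Y i ω) ∈ s k} := by
          rw [lintegral_add_left measurable_const, lintegral_indicator_one hm]
          simp
      _ ≤ 1 + ENNReal.ofReal 0.08 := by gcongr; exact hp k
      _ = ENNReal.ofReal 1.08 := by
          rw [← ENNReal.ofReal_one, ← ENNReal.ofReal_add (by norm_num) (by norm_num)]
          norm_num
  have hcheb := mul_meas_ge_le_lintegral (μ := μ)
    (Finset.measurable_fun_prod Finset.univ fun k _ => (hg k).comp hYm)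
    (ENNReal.ofReal ((2 : ℝ) ^ (0.15 * K : ℝ)))
  have hsub : {ω | 0.15 * (K : ℝ) ≤
      ((Finset.univ.filter fun k => (fun i => Y i ω) ∈ s k).card : ℝ)} ⊆
      {ω | ENNReal.ofReal ((2 : ℝ) ^ (0.15 * K : ℝ)) ≤
        ∏ k, (g k ∘ fun ω i => Y i ω) ω} := by
    intro ω hω
    have : ∏ k, (g k ∘ fun ω i => Y i ω) ω =
        ENNReal.ofReal ((2 : ℝ) ^
          (((Finset.univ.filter fun k => (fun i => Y i ω) ∈ s k).card : ℕ) : ℝ)) := by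
      simp only [g, Function.comp]
      rw [Finset.prod_ite, Finset.prod_const, Finset.prod_const_one, mul_one, Real.rpow_natCast,
        ENNReal.ofReal_pow (by norm_num), ENNReal.ofReal_ofNat]
    rw [Set.mem_ofPred_eq, this]
    exact ENNReal.ofReal_le_ofReal (Real.rpow_le_rpow_of_exponent_le (by norm_num) hω)
  have h2 : (0 : ℝ) < (2 : ℝ) ^ (0.15 * K : ℝ) := by positivity
  have hfin : ENNReal.ofReal ((2 : ℝ) ^ (0.15 * K : ℝ)) * μ {ω | 0.15 * (K : ℝ) ≤
      ((Finset.univ.filter fun k => (fun i => Y i ω) ∈ s k).card : ℝ)} ≤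
      ENNReal.ofReal (1.08 ^ K) := by
    calc _ ≤ _ := by gcongr
      _ ≤ _ := hcheb
      _ = ∏ k, ∫⁻ ω, g k (fun i => Y i ω) ∂μ := hprod
      _ ≤ ∏ _k : Fin K, ENNReal.ofReal 1.08 := Finset.prod_le_prod' fun k _ => hle k
      _ = _ := by
        rw [Finset.prod_const, ENNReal.ofReal_pow (by norm_num), Finset.card_univ,
          Fintype.card_fin]
  rw [mul_comm, ← ENNReal.le_div_iff_mul_le (.inl (by simpa using h2)) (.inl ENNReal.ofReal_ne_top),
    ← ENNReal.ofReal_div_of_pos h2] at hfin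
  refine hfin.trans (ENNReal.ofReal_le_ofReal ?_)
  rw [div_le_iff₀ h2, Real.rpow_def_of_pos (by norm_num), ← Real.exp_add]
  calc (1.08 : ℝ) ^ K ≤ Real.exp 0.08 ^ K := by
        gcongr
        have := Real.add_one_le_exp (0.08 : ℝ)
        norm_num at this ⊢
        exact this
    _ = Real.exp (K * 0.08) := (Real.exp_nat_mul _ _).symm
    _ ≤ _ := Real.exp_le_exp.2 (by
        have := Real.log_two_gt_d9
        nlinarith [Nat.cast_nonneg (α := ℝ) K])

/-- Fubini and Markov: if every section of `H` over the points of `D` has probability at most `q`,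
then the sections over `Ω` fill a fraction `1 / a` of `D` with probability at most `a q`. -/
lemma measure_large_section_le {Ω E : Type*} [MeasurableSpace Ω] [MeasurableSpace E]
    {μ : Measure Ω} [IsProbabilityMeasure μ] {ν : Measure E} [SigmaFinite ν] {D : Set E}
    (h0 : ν D ≠ 0) (htop : ν D ≠ ⊤) {H : Set (Ω × E)}
    (hH : MeasurableSet H) {q a : ENNReal} (hq : ∀ v ∈ D, μ {ω | (ω, v) ∈ H} ≤ q) :
    MeasurableSet {ω | ν D ≤ a * ν {v ∈ D | (ω, v) ∈ H}} ∧
      μ {ω | ν D ≤ a * ν {v ∈ D | (ω, v) ∈ H}} ≤ a * q := by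
  have hsec : ∀ ω, ν {v ∈ D | (ω, v) ∈ H} = ν.restrict D (Prod.mk ω ⁻¹' H) := by
    intro ω
    rw [Measure.restrict_apply (measurable_prodMk_left hH), Set.inter_comm]
    rfl
  simp_rw [hsec]
  have hm : Measurable fun ω => a * ν.restrict D (Prod.mk ω ⁻¹' H) :=
    (measurable_measure_prodMk_left hH).const_mul a
  refine ⟨measurableSet_le measurable_const hm, ?_⟩
  have h1 := mul_meas_ge_le_lintegral (μ := μ) hm (ν D)
  rw [lintegral_const_mul _ (measurable_measure_prodMk_left hH), ← Measure.prod_apply hH,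
    Measure.prod_apply_symm hH] at h1
  have h2 : ∫⁻ v in D, μ ((fun ω => (ω, v)) ⁻¹' H) ∂ν ≤ q * ν D := by
    calc _ ≤ ∫⁻ _ in D, q ∂ν := setLIntegral_mono measurable_const hq
      _ = _ := setLIntegral_const _ _
  refine (ENNReal.mul_le_mul_iff_right h0 htop).1 ?_
  calc ν D * _ ≤ _ := h1
    _ ≤ a * (q * ν D) := by gcongr
    _ = _ := by ring

/-! ### Moments of the quadratic forms -/

lemma continuous_quad {d : ℕ} (S : Matrix (Fin d) (Fin d) ℝ) (u : Fin d → ℝ) :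
    Continuous fun y : Fin d → ℝ => u ⬝ᵥ ((S - vecMulVec y y) *ᵥ u) := by
  fun_prop

lemma integral_quad_eq_zero {d : ℕ} {P : Measure (Fin d → ℝ)} [IsProbabilityMeasure P]
    (hP : MemLp id 2 P) (hmean : mean P = 0) (u : Fin d → ℝ) :
    ∫ y, u ⬝ᵥ ((covMat P - vecMulVec y y) *ᵥ u) ∂P = 0 := by
  have hc : ∀ i, MemLp (fun y : Fin d → ℝ => y i) 2 P := fun i =>
    (memLp_pi_iff.1 hP) i
  have hint : ∀ i j, Integrable (fun y : Fin d → ℝ => y i * y j) P := fun i j =>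
    (hc i).integrable_mul (hc j)
  have hcov : ∀ i j, covMat P i j = ∫ y, y i * y j ∂P := by
    intro i j
    simp [covMat, hmean]
  have hint' : ∀ i j, Integrable (fun y : Fin d → ℝ => (covMat P i j - y i * y j) * u j) P :=
    fun i j => ((integrable_const _).sub (hint i j)).mul_const _
  simp only [dotProduct, mulVec, Matrix.sub_apply, vecMulVec_apply]
  rw [integral_finsetSum _ fun i _ => (integrable_finsetSum _ fun j _ => hint' i j).const_mul _]
  refine Finset.sum_eq_zero fun i _ => ?_
  rw [integral_const_mul, integral_finsetSum _ fun j _ => hint' i j,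
    Finset.sum_eq_zero, mul_zero]
  intro j _
  rw [integral_mul_const, integral_sub (integrable_const _) (hint i j), hcov]
  simp

lemma memLp_quad {d : ℕ} {G : Matrix (Fin d) (Fin d) ℝ} {P : Measure (Fin d → ℝ)}
    (hσ : sigmaSq G P ≠ ⊤) {u : Fin d → ℝ} (hu : u ∈ dualBall G) :
    MemLp (fun y => u ⬝ᵥ ((covMat P - vecMulVec y y) *ᵥ u)) 2 P ∧
      ∫ y, (u ⬝ᵥ ((covMat P - vecMulVec y y) *ᵥ u)) ^ 2 ∂P ≤ sigma G P ^ 2 := by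
  have hle : ∫⁻ y, ENNReal.ofReal ((u ⬝ᵥ ((covMat P - vecMulVec y y) *ᵥ u)) ^ 2) ∂P ≤
      sigmaSq G P := le_iSup₂ (f := fun u (_ : u ∈ dualBall G) =>
        ∫⁻ y, ENNReal.ofReal ((u ⬝ᵥ ((covMat P - vecMulVec y y) *ᵥ u)) ^ 2) ∂P) u hu
  have hm := continuous_quad (covMat P) u
  constructor
  · rw [memLp_two_iff_integrable_sq hm.aestronglyMeasurable,
      ← lintegral_ofReal_ne_top_iff_integrable (by fun_prop)
        (.of_forall fun _ => sq_nonneg _)]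
    exact (hle.trans_lt (lt_top_iff_ne_top.2 hσ)).ne
  · rw [integral_eq_lintegral_of_nonneg_ae (.of_forall fun _ => sq_nonneg _)
      (by fun_prop), sigma, Real.sq_sqrt ENNReal.toReal_nonneg]
    exact ENNReal.toReal_mono hσ hle

lemma quad_blockMat_sub {d N : ℕ} (S : Matrix (Fin d) (Fin d) ℝ) (x : Fin N → Fin d → ℝ)
    {b : Finset (Fin N)} (hb : 0 < b.card) (u : Fin d → ℝ) :
    u ⬝ᵥ ((blockMat x b - S) *ᵥ u) =
      -((b.card : ℝ)⁻¹ * ∑ i ∈ b, u ⬝ᵥ ((S - vecMulVec (x i) (x i)) *ᵥ u)) := by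
  have hb' : (b.card : ℝ) ≠ 0 := by positivity
  simp only [sub_mulVec, dotProduct_sub, blockMat, smul_mulVec, dotProduct_smul, smul_eq_mul,
    Finset.sum_sub_distrib, Finset.sum_const, nsmul_eq_mul, sum_mulVec, dotProduct_sum]
  field_simp
  ring

/-- Chebyshev's inequality for a clean block. For `ρ = 0` the hypothesis forces `σ = 0`, and the
deviation vanishes almost surely. -/
lemma measure_quad_block_le {d N : ℕ} {G : Matrix (Fin d) (Fin d) ℝ} {P : Measure (Fin d → ℝ)}
    [IsProbabilityMeasure P] (hP : MemLp id 2 P) (hmean : mean P = 0) (hσ : sigmaSq G P ≠ ⊤)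
    {Ω : Type*} [MeasurableSpace Ω] {μ : Measure Ω} [IsProbabilityMeasure μ]
    {Y : Fin N → Ω → Fin d → ℝ} (hlaw : ∀ i, HasLaw (Y i) P μ) (hind : iIndepFun Y μ)
    {b : Finset (Fin N)} (hb : 0 < b.card) {ρ p : ℝ} (hρ : 0 ≤ ρ)
    (h : sigma G P ^ 2 ≤ p * b.card * ρ ^ 2) {u : Fin d → ℝ} (hu : u ∈ dualBall G) :
    μ {ω | ρ < |u ⬝ᵥ ((blockMat (fun i => Y i ω) b - covMat P) *ᵥ u)|} ≤ ENNReal.ofReal p := by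
  obtain ⟨hL, hsq⟩ := memLp_quad hσ hu
  have hcont := continuous_quad (covMat P) u
  have h0 := integral_quad_eq_zero hP hmean u
  set φ : (Fin d → ℝ) → ℝ := fun y => u ⬝ᵥ ((covMat P - vecMulVec y y) *ᵥ u) with hφ
  have hLi : ∀ i, MemLp (φ ∘ Y i) 2 μ := fun i => by
    refine MemLp.comp_of_map ?_ (hlaw i).aemeasurable
    rwa [(hlaw i).map_eq]
  have hEi : ∀ i, ∫ ω, φ (Y i ω) ∂μ = 0 := fun i => by
    have := (hlaw i).integral_comp (f := φ) hcont.aestronglyMeasurable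
    rw [← h0, ← this]
    rfl
  have hVi : ∀ i, Var[φ ∘ Y i; μ] ≤ sigma G P ^ 2 := fun i => by
    rw [variance_of_integral_eq_zero (hLi i).aemeasurable (hEi i)]
    have := (hlaw i).integral_comp (f := fun y => φ y ^ 2) (hcont.pow 2).aestronglyMeasurable
    calc _ = _ := this
      _ ≤ _ := hsq
  set Z : Ω → ℝ := ∑ i ∈ b, φ ∘ Y i with hZ
  have hZL : MemLp Z 2 μ := memLp_finsetSum' _ fun i _ => hLi i
  have hZE : ∫ ω, Z ω ∂μ = 0 := by
    simp only [hZ, Finset.sum_apply]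
    rw [integral_finsetSum _ fun i _ => (hLi i).integrable one_le_two]
    exact Finset.sum_eq_zero fun i _ => hEi i
  have hZV : Var[Z; μ] ≤ b.card * sigma G P ^ 2 := by
    rw [hZ, IndepFun.variance_sum (fun i _ => hLi i) fun i _ j _ hij =>
      (hind.indepFun hij).comp hcont.measurable hcont.measurable, ← nsmul_eq_mul]
    exact Finset.sum_le_card_nsmul _ _ _ fun i _ => hVi i
  have hb' : (0 : ℝ) < b.card := by exact_mod_cast hb
  have hset : {ω | ρ < |u ⬝ᵥ ((blockMat (fun i => Y i ω) b - covMat P) *ᵥ u)|} =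
      {ω | b.card * ρ < |Z ω|} := by
    ext ω
    have : ∑ i ∈ b, u ⬝ᵥ ((covMat P - vecMulVec (Y i ω) (Y i ω)) *ᵥ u) = Z ω := by
      simp [hZ, hφ]
    simp only [Set.mem_ofPred_eq]
    rw [quad_blockMat_sub _ _ hb, abs_neg, abs_mul, abs_of_pos (inv_pos.2 hb'), this,
      inv_mul_eq_div, lt_div_iff₀' hb']
  rw [hset]
  rcases hρ.eq_or_lt with rfl | hρ
  · have hs0 : sigma G P ^ 2 ≤ 0 := by simpa using h
    have hv : Var[Z; μ] = 0 :=
      le_antisymm (hZV.trans (mul_nonpos_of_nonneg_of_nonpos hb'.le hs0)) (variance_nonneg _ _)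
    rw [variance_of_integral_eq_zero hZL.aemeasurable hZE,
      integral_eq_zero_iff_of_nonneg (fun _ => sq_nonneg _) hZL.integrable_sq] at hv
    have : μ {ω | (b.card : ℝ) * 0 < |Z ω|} = 0 := by
      refine measure_mono_null ?_ (ae_iff.1 hv)
      intro ω hω
      simpa using hω
    rw [this]
    exact zero_le
  · have hbr : 0 < b.card * ρ := mul_pos hb' hρ
    calc μ {ω | b.card * ρ < |Z ω|} ≤ μ {ω | b.card * ρ ≤ |Z ω - ∫ x, Z x ∂μ|} :=
          measure_mono fun ω hω => by
            simp only [Set.mem_ofPred_eq, hZE, sub_zero] at hω ⊢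
            exact hω.le
      _ ≤ _ := meas_ge_le_variance_div_sq hZL hbr
      _ ≤ _ := by
          refine ENNReal.ofReal_le_ofReal ?_
          rw [div_le_iff₀ (by positivity)]
          calc _ ≤ _ := hZV
            _ ≤ b.card * (p * b.card * ρ ^ 2) := by gcongr
            _ = _ := by ring

/-! ### Uniform control of the clean blocks -/

lemma blockMat_congr {d N : ℕ} {x y : Fin N → Fin d → ℝ} {b : Finset (Fin N)}
    (h : ∀ i ∈ b, x i = y i) : blockMat x b = blockMat y b := by
  simp only [blockMat]
  rw [Finset.sum_congr rfl fun i hi => by rw [h i hi]]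

lemma continuous_quad_blockMat {d N : ℕ} (S : Matrix (Fin d) (Fin d) ℝ) (b : Finset (Fin N)) :
    Continuous fun p : (Fin N → Fin d → ℝ) × (Fin d → ℝ) =>
      p.2 ⬝ᵥ ((blockMat p.1 b - S) *ᵥ p.2) := by
  unfold blockMat
  fun_prop

/-- The size of a block times the number of blocks is at least `0.9 N`. -/
lemma block_size_bound {N K : ℕ} (hK : 0 < K) (hKN : 10 * K ≤ N) :
    0 < N / K ∧ 0.9 * (N : ℝ) ≤ ((N / K : ℕ) : ℝ) * K := by
  refine ⟨Nat.div_pos (by omega) hK, ?_⟩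
  have h1 := Nat.div_add_mod N K
  have h2 := Nat.mod_lt N hK
  have h3 : 9 * N ≤ 10 * (N / K * K) := by
    rw [mul_comm (N / K)]
    omega
  have h4 : (9 * N : ℝ) ≤ 10 * (((N / K : ℕ) : ℝ) * K) := by exact_mod_cast h3
  linarith

/-- Outside an event that is exponentially small in `K`, simultaneously for all `u` in the dual
ball, fewer than `45 %` of the clean blocks deviate by more than `4 σ √(K / N)` at `u`. -/
lemma exists_uniform_event {d N K : ℕ} {G : Matrix (Fin d) (Fin d) ℝ} (hG : G.PosDef)
    {P : Measure (Fin d → ℝ)} [IsProbabilityMeasure P] (hP : MemLp id 2 P) (hmean : mean P = 0)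
    (hσ : sigmaSq G P ≠ ⊤) {Ω : Type*} [MeasurableSpace Ω] {μ : Measure Ω}
    [IsProbabilityMeasure μ] {Y : Fin N → Ω → Fin d → ℝ} (hY : ∀ i, Measurable (Y i))
    (hlaw : ∀ i, HasLaw (Y i) P μ) (hind : iIndepFun Y μ) (hK : 0 < K) (hKN : 10 * K ≤ N)
    {B : Fin K → Finset (Fin N)} (hB : IsBlocking B) :
    ∃ F : Set Ω, MeasurableSet F ∧
      μ F ≤ ENNReal.ofReal (6 * 1000000 ^ d * Real.exp (-(K / 50))) ∧
      ∀ ω ∉ F, ∀ u ∈ dualBall G,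
        ((exceed (fun k => blockMat (fun i => Y i ω) (B k) - covMat P)
          (4 * sigma G P * √((K : ℝ) / N)) u).card : ℝ) < 0.45 * K := by
  classical
  set r := 4 * sigma G P * √((K : ℝ) / N) with hr
  have hσ0 : 0 ≤ sigma G P := Real.sqrt_nonneg _
  have hr0 : 0 ≤ r := by positivity
  have hYm : Measurable fun ω i => Y i ω := measurable_pi_lambda _ hY
  have hK' : (0 : ℝ) < K := by exact_mod_cast hK
  have hN' : (0 : ℝ) < N := by exact_mod_cast (by omega : 0 < N)
  obtain ⟨hm, hmK⟩ := block_size_bound hK hKN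
  let A : Ω → Fin K → Matrix (Fin d) (Fin d) ℝ :=
    fun ω k => blockMat (fun i => Y i ω) (B k) - covMat P
  have hbad : ∀ k, Measurable fun p : Ω × (Fin d → ℝ) => |p.2 ⬝ᵥ (A p.1 k *ᵥ p.2)| := by
    intro k
    have := (continuous_quad_blockMat (covMat P) (B k)).abs.measurable.comp
      ((hYm.comp measurable_fst).prodMk (measurable_snd (α := Ω) (β := Fin d → ℝ)))
    exact this
  let H : Set (Ω × (Fin d → ℝ)) :=
    {p | 0.15 * (K : ℝ) ≤ ((exceed (A p.1) (0.97 * r) p.2).card : ℝ)}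
  have hH : MeasurableSet H := by
    refine measurableSet_le measurable_const ?_
    simp only [exceed, Finset.card_filter, Nat.cast_sum, Nat.cast_ite]
    exact Finset.measurable_fun_sum _ fun k _ =>
      Measurable.ite (measurableSet_lt measurable_const (hbad k)) measurable_const
        measurable_const
  have hq : ∀ v ∈ dualBall G, μ {ω | (ω, v) ∈ H} ≤ ENNReal.ofReal (Real.exp (-(K / 50))) := by
    intro v hv
    let s : Fin K → Set (Fin N → Fin d → ℝ) :=
      fun k => {y | 0.97 * r < |v ⬝ᵥ ((blockMat y (B k) - covMat P) *ᵥ v)|}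
    have hs : ∀ k, MeasurableSet (s k) := fun k =>
      measurableSet_lt measurable_const ((continuous_quad_blockMat (covMat P) (B k)).abs.comp
        (continuous_id.prodMk continuous_const)).measurable
    have hp : ∀ k, μ {ω | (fun i => Y i ω) ∈ s k} ≤ ENNReal.ofReal 0.08 := by
      intro k
      refine measure_quad_block_le hP hmean hσ hlaw hind (by rw [hB.1 k]; exact hm)
        (by positivity) ?_ hv
      rw [hB.1 k, hr, mul_pow, mul_pow, mul_pow, Real.sq_sqrt (by positivity)]
      have : (0.9 : ℝ) ≤ ((N / K : ℕ) : ℝ) * (K / N) := by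
        rw [← mul_div_assoc, le_div_iff₀ hN']
        exact hmK
      -- The margin is `0.08 * 0.97 ^ 2 * 16 * 0.9 > 1`.
      nlinarith [sq_nonneg (sigma G P), mul_le_mul_of_nonneg_left this (sq_nonneg (sigma G P))]
    have := measure_card_blocks_le hY hind hB.2 hs
      (fun k y y' h => by simp only [s, Set.mem_ofPred_eq, blockMat_congr h]) hp
    refine le_trans (measure_mono fun ω hω => ?_) this
    simp only [H, exceed, A, Set.mem_ofPred_eq] at hω
    simp only [s, Set.mem_ofPred_eq]
    convert hω
  obtain ⟨hF, hFle⟩ := measure_large_section_le (ν := volume) (volume_dualBall_pos hG).ne'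
    (volume_dualBall_ne_top hG) hH hq (a := ENNReal.ofReal (6 * 1000000 ^ d))
  refine ⟨_, hF, ?_, fun ω hω u hu => ?_⟩
  · rwa [← ENNReal.ofReal_mul (by positivity)] at hFle
  · by_contra! hc
    exact hω (volume_dualBall_le (A ω) hr0 (n := 0.15 * K) hu (by linarith))

/-! ### Contamination and the deterministic part -/

/-- If fewer than `45 %` of the clean blocks deviate by more than `r` at every extreme dual vector
and at most `5 %` of the blocks can be contaminated, then `S` belongs to the median set. -/
lemma mem_momSet_of_exceed_lt {d N K : ℕ} {G S : Matrix (Fin d) (Fin d) ℝ} {ε r : ℝ}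
    (hε : 0 ≤ ε) {x y : Fin N → Fin d → ℝ} (hxy : IsContamination ε y x)
    {B : Fin K → Finset (Fin N)} (hB : IsBlocking B) (hK : 20 * (ε * N) ≤ K)
    (h : ∀ u ∈ dualBall G,
      ((exceed (fun k => blockMat y (B k) - S) r u).card : ℝ) < 0.45 * K) :
    S ∈ momSet G x B r := by
  classical
  obtain ⟨O, hO, hO'⟩ := hxy
  refine Set.mem_iInter₂.2 fun u hu => ?_
  have hu' : u ∈ dualBall G := hu.1
  have hOε : (O.card : ℝ) ≤ ε * N := (Nat.cast_le.2 hO).trans (Nat.floor_le (by positivity))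
  let T : Finset (Fin K) := Finset.univ.filter fun k => ¬ Disjoint (B k) O
  have hT : T.card ≤ O.card := by
    have hne : ∀ k ∈ T, ∃ i ∈ O, i ∈ B k := fun k hk => by
      obtain ⟨i, hi, hi'⟩ := Finset.not_disjoint_iff.1 (Finset.mem_filter.1 hk).2
      exact ⟨i, hi', hi⟩
    refine Finset.card_le_card_of_forall_subsingleton (fun k i => i ∈ B k) hne ?_
    intro i _ k hk l hl
    by_contra hkl
    exact Finset.disjoint_left.1 (hB.2 hkl) hk.2 hl.2
  set X := exceed (fun k => blockMat y (B k) - S) r u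
  have hsub : ((Finset.univ \ (X ∪ T) : Finset (Fin K)) : Set (Fin K)) ⊆
      {k | |pairing (blockMat x (B k) - S) (vecMulVec u u)| ≤ r} := by
    intro k hk
    simp only [Finset.coe_sdiff, Finset.coe_univ, Set.mem_sdiff, Set.mem_univ, true_and,
      Finset.mem_coe, Finset.mem_union, not_or, X, T, exceed, Finset.mem_filter,
      Finset.mem_univ, not_not, not_lt] at hk
    rw [Set.mem_ofPred_eq, pairing_vecMulVec,
      blockMat_congr fun i hi => hO' i (Finset.disjoint_left.1 hk.2 hi)]
    exact hk.1
  have hc := Set.ncard_le_ncard hsub (Set.toFinite _)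
  rw [Set.ncard_coe_finset] at hc
  have h1 : K ≤ (Finset.univ \ (X ∪ T) : Finset (Fin K)).card + (X.card + T.card) := by
    have h2 := Finset.card_sdiff_add_card (Finset.univ : Finset (Fin K)) (X ∪ T)
    have h3 := Finset.card_union_le X T
    have h4 := Finset.card_le_card (Finset.subset_univ (X ∪ T))
    rw [Finset.union_eq_left.2 (Finset.subset_univ _), Finset.card_univ, Fintype.card_fin] at h2
    omega
  have h2 : K ≤ {k | |pairing (blockMat x (B k) - S) (vecMulVec u u)| ≤ r}.ncard +
    (X.card + O.card) := by omega
  have h3 : (K : ℝ) ≤ ({k | |pairing (blockMat x (B k) - S) (vecMulVec u u)| ≤ r}.ncard : ℝ) +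
    ((X.card : ℝ) + O.card) := by exact_mod_cast h2
  have h4 := h u hu'
  change (K : ℝ) / 2 < _
  linarith

/-- Two majorities of blocks share a block, so two symmetric elements of the median set of radius
`r` are within `2 r` of each other. -/
lemma opNrm_sub_le_of_mem_momSet {d N K : ℕ} {G S A : Matrix (Fin d) (Fin d) ℝ} (hG : G.PosDef)
    {r : ℝ} (hr : 0 ≤ r) {x : Fin N → Fin d → ℝ} {B : Fin K → Finset (Fin N)}
    (hS : S ∈ momSet G x B r) (hA : A ∈ momSet G x B r) (hSs : S.IsSymm) (hAs : A.IsSymm) :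
    opNrm G (S - A) ≤ 2 * r := by
  refine opNrm_le_of_quad_le hG (hSs.sub hAs) (by linarith) fun u hu => ?_
  have h1 : (K : ℝ) / 2 < _ := Set.mem_iInter₂.1 hS u hu
  have h2 : (K : ℝ) / 2 < _ := Set.mem_iInter₂.1 hA u hu
  set s := {k : Fin K | |pairing (blockMat x (B k) - S) (vecMulVec u u)| ≤ r}
  set t := {k : Fin K | |pairing (blockMat x (B k) - A) (vecMulVec u u)| ≤ r}
  have hne : (s ∩ t).Nonempty := by
    by_contra hemp
    rw [Set.not_nonempty_iff_eq_empty] at hemp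
    have h3 := Set.ncard_union_eq (Set.disjoint_iff_inter_eq_empty.2 hemp)
      (Set.toFinite s) (Set.toFinite t)
    have h4 := Set.ncard_le_ncard (Set.subset_univ (s ∪ t)) (Set.toFinite _)
    rw [Set.ncard_univ, Nat.card_eq_fintype_card, Fintype.card_fin, h3] at h4
    have h5 : (s.ncard : ℝ) + t.ncard ≤ K := by exact_mod_cast h4
    linarith
  obtain ⟨k, hk1, hk2⟩ := hne
  simp only [s, t, Set.mem_ofPred_eq, pairing_vecMulVec, sub_mulVec, dotProduct_sub] at hk1 hk2
  rw [sub_mulVec, dotProduct_sub]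
  rw [abs_le] at *
  constructor <;> linarith [hk1.1, hk1.2, hk2.1, hk2.2]

lemma isSymm_covMat {d : ℕ} (P : Measure (Fin d → ℝ)) : (covMat P).IsSymm := by
  ext i j
  simp only [transpose_apply, covMat, of_apply]
  simp_rw [mul_comm]

/-! ### Choice of the number of blocks -/

/-- The number of blocks `K` is a large multiple of `L + V + ε N`, `L = log (1 / δ)`, rounded up;
the rounding is absorbed in `L`, which is at least `log 2`. -/
lemma exists_block_number {N V : ℕ} {L ε : ℝ} (hL2 : 0.69 ≤ L) (hL : L ≤ 1 / 10000 * N)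
    (hV : (V : ℝ) ≤ 1 / 10000 * N) (hε : 0 ≤ ε) (hεc : ε ≤ 1 / 10000) :
    ∃ K : ℕ, 0 < K ∧ 10 * K ≤ N ∧ 200 * L + 700 * V + 20 * (ε * N) ≤ K ∧
      (K : ℝ) ≤ 202 * L + 700 * V + 20 * (ε * N) := by
  have hN : (0 : ℝ) ≤ N := Nat.cast_nonneg _
  have hV0 : (0 : ℝ) ≤ V := Nat.cast_nonneg _
  have hεN : 0 ≤ ε * N := mul_nonneg hε hN
  have hεN' : ε * N ≤ 1 / 10000 * N := by gcongr
  have h1 := Nat.le_ceil (200 * L + 700 * V + 20 * (ε * N))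
  have h2 := Nat.ceil_lt_add_one (a := 200 * L + 700 * V + 20 * (ε * N)) (by positivity)
  refine ⟨_, Nat.ceil_pos.2 (by positivity), ?_, h1, by linarith⟩
  have : (10 * ⌈200 * L + 700 * V + 20 * (ε * N)⌉₊ : ℝ) ≤ N := by linarith
  exact_mod_cast this

lemma failure_prob_le {d V K : ℕ} {δ L : ℝ} (hδ : 0 < δ) (hL : L = Real.log (1 / δ))
    (hL2 : Real.log 2 ≤ L) (hd : d ≤ V) (hK : 200 * L + 700 * V ≤ K) :
    6 * 1000000 ^ d * Real.exp (-((K : ℝ) / 50)) ≤ δ := by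
  have hδ' : δ = Real.exp (-L) := by
    rw [hL, one_div, Real.log_inv, neg_neg, Real.exp_log hδ]
  have h2 : Real.exp (Real.log 2) = 2 := Real.exp_log (by norm_num)
  have h6 : (6 : ℝ) ≤ Real.exp (3 * L) := by
    calc (6 : ℝ) ≤ 2 ^ 3 := by norm_num
      _ = Real.exp (3 * Real.log 2) := by rw [← h2, ← Real.exp_nat_mul, h2]; norm_num
      _ ≤ _ := Real.exp_le_exp.2 (by linarith)
  have hM : (1000000 : ℝ) ^ d ≤ Real.exp (14 * V) := by
    calc (1000000 : ℝ) ^ d ≤ Real.exp 14 ^ d := by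
          gcongr
          calc (1000000 : ℝ) ≤ 2 ^ 20 := by norm_num
            _ = Real.exp (20 * Real.log 2) := by rw [← h2, ← Real.exp_nat_mul, h2]; norm_num
            _ ≤ _ := Real.exp_le_exp.2 (by linarith [Real.log_two_lt_d9])
      _ = Real.exp (d * 14) := (Real.exp_nat_mul _ _).symm
      _ ≤ _ := Real.exp_le_exp.2 (by
          have : (d : ℝ) ≤ V := by exact_mod_cast hd
          linarith)
  calc 6 * 1000000 ^ d * Real.exp (-((K : ℝ) / 50))
      ≤ Real.exp (3 * L) * Real.exp (14 * V) * Real.exp (-((K : ℝ) / 50)) := by gcongr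
    _ = Real.exp (3 * L + 14 * V - K / 50) := by
        rw [← Real.exp_add, ← Real.exp_add]
        congr 1
    _ ≤ δ := by
        rw [hδ']
        exact Real.exp_le_exp.2 (by linarith)

lemma sqrt_block_ratio_le {N V K : ℕ} {L ε : ℝ} (hN : 0 < N) (hL : 0 ≤ L) (hε : 0 ≤ ε)
    (hK : (K : ℝ) ≤ 202 * L + 700 * V + 20 * (ε * N)) :
    √((K : ℝ) / N) ≤ 27 * (√((V : ℝ) / N) + √(128 * L / N) + √ε) := by
  have hN' : (0 : ℝ) < N := by exact_mod_cast hN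
  have h1 : 0 ≤ (V : ℝ) / N := by positivity
  have h2 : 0 ≤ 128 * L / N := by positivity
  have e1 := Real.sq_sqrt h1
  have e2 := Real.sq_sqrt h2
  have e3 := Real.sq_sqrt hε
  have p1 := Real.sqrt_nonneg ((V : ℝ) / N)
  have p2 := Real.sqrt_nonneg (128 * L / N)
  have p3 := Real.sqrt_nonneg ε
  refine Real.sqrt_le_iff.2 ⟨by positivity, ?_⟩
  have h3 : (K : ℝ) / N ≤ 202 / 128 * (128 * L / N) + 700 * ((V : ℝ) / N) + 20 * ε := by
    rw [div_le_iff₀ hN']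
    have : (202 / 128 * (128 * L / N) + 700 * ((V : ℝ) / N) + 20 * ε) * N =
      202 * L + 700 * V + 20 * (ε * N) := by field_simp
    rw [this]
    exact hK
  calc (K : ℝ) / N ≤ _ := h3
    _ ≤ 729 * (√((V : ℝ) / N) ^ 2 + √(128 * L / N) ^ 2 + √ε ^ 2) := by
        rw [e1, e2, e3]
        linarith
    _ ≤ _ := by nlinarith [mul_nonneg p1 p2, mul_nonneg p1 p3, mul_nonneg p2 p3]

end MOMCov

theorem theorem4p1 :
    ∃ c : ℝ, 0 < c ∧ ∃ C : ℝ, 0 < C ∧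
      ∀ (d N : ℕ) (G : Matrix (Fin d) (Fin d) ℝ), G.PosDef →
      ∀ V : ℕ, MOMCov.vcVec (MOMCov.extremeDual G) = (V : ℕ∞) →
      ∀ δ ε : ℝ, Real.exp (-(c * N)) ≤ δ → δ ≤ 1 / 2 → 0 ≤ ε → ε ≤ c → (V : ℝ) ≤ c * N →
      ∃ K : ℕ, 0 < K ∧ K ≤ N ∧
        ∀ P : Measure (Fin d → ℝ), IsProbabilityMeasure P → MemLp id 2 P →
          MOMCov.mean P = 0 → MOMCov.sigmaSq G P ≠ ⊤ →
        ∀ (Ω : Type*) (_ : MeasurableSpace Ω) (μ : Measure Ω), IsProbabilityMeasure μ →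
        ∀ Y : Fin N → Ω → Fin d → ℝ, (∀ i, HasLaw (Y i) P μ) → iIndepFun Y μ →
        ∀ X : Fin N → Ω → Fin d → ℝ,
          (∀ᵐ ω ∂μ, MOMCov.IsContamination ε (fun i => Y i ω) (fun i => X i ω)) →
        ∀ B : Fin K → Finset (Fin N), MOMCov.IsBlocking B →
        ∃ E : Set Ω, MeasurableSet E ∧ 1 - δ ≤ μ.real E ∧ ∀ ω ∈ E,
          let S := MOMCov.momSet G (fun i => X i ω) B
            (4 * MOMCov.sigma G P * √((K : ℝ) / N))
          (∃ A ∈ S, A.IsSymm) ∧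
          ∀ A ∈ S, A.IsSymm →
            MOMCov.opNrm G (MOMCov.covMat P - A) ≤
              C * (MOMCov.sigma G P *
                (√((V : ℝ) / N) + √(128 * Real.log (1 / δ) / N) + √ε)) := by
  refine ⟨1 / 10000, by norm_num, 216, by norm_num, ?_⟩
  intro d N G hG V hV δ ε hδ hδ2 hε hεc hVN
  have hδ0 : 0 < δ := (Real.exp_pos _).trans_le hδ
  have hdV : d ≤ V := by
    have := MOMCov.dim_le_vcVec hG
    rw [hV] at this
    exact_mod_cast this
  set L := Real.log (1 / δ) with hL
  have hL2 : Real.log 2 ≤ L := by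
    refine Real.log_le_log (by norm_num) ?_
    rw [le_div_iff₀ hδ0]
    linarith
  have hL2' : 0.69 ≤ L := by linarith [Real.log_two_gt_d9]
  have hLN : L ≤ 1 / 10000 * N := by
    have := Real.log_le_log (Real.exp_pos _) hδ
    rw [Real.log_exp] at this
    rw [hL, one_div, Real.log_inv]
    linarith
  obtain ⟨K, hK, hKN, hKl, hKu⟩ := MOMCov.exists_block_number hL2' hLN hVN hε hεc
  have hεN : 0 ≤ ε * N := by positivity
  have hV0 : (0 : ℝ) ≤ V := Nat.cast_nonneg _
  refine ⟨K, hK, by omega, ?_⟩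
  intro P _ hP hmean hσ Ω _ μ _ Y hlaw hind X hX B hB
  -- `HasLaw` gives a.e.-measurability only, so the clean sample is replaced by a measurable version.
  let Y' : Fin N → Ω → Fin d → ℝ := fun i => (hlaw i).aemeasurable.mk (Y i)
  have hYY' : ∀ i, Y i =ᵐ[μ] Y' i := fun i => (hlaw i).aemeasurable.ae_eq_mk
  have hY' : ∀ i, Measurable (Y' i) := fun i => (hlaw i).aemeasurable.measurable_mk
  obtain ⟨F, hF, hFμ, hFu⟩ := MOMCov.exists_uniform_event hG hP hmean hσ hY'
    (fun i => (hlaw i).congr (hYY' i).symm) (hind.congr hYY') hK hKN hB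
  have hae : ∀ᵐ ω ∂μ, MOMCov.IsContamination ε (fun i => Y' i ω) (fun i => X i ω) := by
    filter_upwards [hX, ae_all_iff.2 hYY'] with ω h1 h2
    simpa only [h2] using h1
  obtain ⟨Z, hZsub, hZm, hZ0⟩ := exists_measurable_superset_of_null (ae_iff.1 hae)
  refine ⟨(F ∪ Z)ᶜ, (hF.union hZm).compl, ?_, fun ω hω => ?_⟩
  · rw [probReal_compl_eq_one_sub (hF.union hZm)]
    have h1 : μ (F ∪ Z) ≤ ENNReal.ofReal δ := by
      calc μ (F ∪ Z) ≤ μ F + μ Z := measure_union_le _ _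
        _ = μ F := by rw [hZ0, add_zero]
        _ ≤ _ := hFμ
        _ ≤ _ := ENNReal.ofReal_le_ofReal
          (MOMCov.failure_prob_le hδ0 hL hL2 hdV (by linarith))
    have h2 := ENNReal.toReal_le_of_le_ofReal hδ0.le h1
    rw [Measure.real]
    linarith
  · have hωF : ω ∉ F := fun h => hω (.inl h)
    have hωZ : MOMCov.IsContamination ε (fun i => Y' i ω) (fun i => X i ω) := by
      by_contra h
      exact hω (.inr (hZsub h))
    have hmem := MOMCov.mem_momSet_of_exceed_lt hε hωZ hB (by linarith) (hFu ω hωF)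
    have hσ0 : 0 ≤ MOMCov.sigma G P := Real.sqrt_nonneg _
    refine ⟨⟨_, hmem, MOMCov.isSymm_covMat P⟩, fun A hA hAs => ?_⟩
    calc _ ≤ 2 * (4 * MOMCov.sigma G P * √((K : ℝ) / N)) :=
          MOMCov.opNrm_sub_le_of_mem_momSet hG (by positivity) hmem hA
            (MOMCov.isSymm_covMat P) hAs
      _ ≤ 2 * (4 * MOMCov.sigma G P *
          (27 * (√((V : ℝ) / N) + √(128 * L / N) + √ε))) := by
          gcongr
          exact MOMCov.sqrt_block_ratio_le (by omega) (by linarith) hε hKu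
      _ = _ := by ring
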